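/- A fullerene is a trivalent map on the oriented sphere all of whose faces are pentagons or hexagons. Its dual is a triangulation with one triangle per carbon atom and with vertices of degree 5 (pentagons) and 6 (hexagons). Make every triangle of the dual a flat equilateral triangle with sides of length 1, and measure area so that each of these triangles has area 1. Put $\omega = e^{2\pi i/6}$. For integers $k,l$, not both zero, the Goldberg–Coxeter transformation $(k,l)$ of a fullerene $A$ replaces each triangle of the dual of $A$ by the equilateral patch of the triangular lattice $\mathbb{Z}[\omega]$ with corners $0$, $k+l\omega$, $(k+l\omega)\omega$, the patches being glued along their sides as the triangles were. Its area scale factor $N_{kl}$ is the area of this patch. A master polyhedron of a fullerene $F$ is a decomposition of its flat surface into flat geodesic triangles (the facets, whose sides are the master edges) with the centres of the pentagons of $F$ as vertices. Theorem 3. Let $F$ be a fullerene that is obtained from a fullerene $A$ by the Goldberg–Coxeter transformation $(k,l)$. Then $N_{kl} = k^2+kl+l^2$ is an integer, and for every master polyhedron of $F$ the areas of all facets and the squares of the lengths of all master edges are integers divisible by $N_{kl}$. -/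

import Mathlib

noncomputable section

/-- The Eisenstein integers `a + b ω`, where `ω ^ 2 = ω - 1`; `re` is `a` and `im` is `b`. -/
abbrev Eisenstein : Type := QuadraticAlgebra ℤ (-1) 1

namespace Eisenstein

/-- `ω`, a primitive sixth root of unity, as a unit of the ring of Eisenstein integers.
The units of this ring are the six powers of `ω`. -/
def ω : Eisensteinˣ where
  val := ⟨0, 1⟩
  inv := ⟨1, -1⟩
  val_inv := by ext <;> simp [QuadraticAlgebra.re_one, QuadraticAlgebra.im_one]
  inv_val := by ext <;> simp [QuadraticAlgebra.re_one, QuadraticAlgebra.im_one]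

/-- The position of `a + b ω` in the plane, with `ω = exp (2 π i / 6)`. -/
def toPlane (x : Eisenstein) : ℂ :=
  (x.re : ℂ) + (x.im : ℂ) * Complex.exp (2 * Real.pi * Complex.I / 6)

/-- The determinant of `a + b ω` and `c + d ω`. -/
def det (x y : Eisenstein) : ℤ := x.re * y.im - x.im * y.re

/-- The closed triangle in the plane with the given lattice points as corners. -/
def triangle (x y z : Eisenstein) : Set ℂ :=
  convexHull ℝ {toPlane x, toPlane y, toPlane z}

/-- The area of a plane region, in the unit in which the lattice triangle with corners
`0`, `1`, `ω` (one carbon atom) has area `1`. -/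
def area (S : Set ℂ) : ℝ :=
  MeasureTheory.volume.real S / MeasureTheory.volume.real (triangle 0 1 ω)

end Eisenstein

open Eisenstein in
/-- The area scale factor of the transformation `(k, l)`: the area of the equilateral graphene
patch on the segment from `0` to `k + l ω`, which takes the place of a triangle of area `1`. -/
def areaScaleFactor (k l : ℤ) : ℝ :=
  area (triangle 0 ⟨k, l⟩ (⟨k, l⟩ * ω))

/-- A directed edge of the triangular lattice of Eisenstein integers: it leads from `base` to
`base + dir`. It also stands for the small lattice triangle on its left. -/
structure LatticeDart where
  base : Eisenstein
  dir : Eisensteinˣ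

namespace LatticeDart

open Eisenstein

/-- The next edge, counterclockwise, of the small triangle on the left. -/
def next (s : LatticeDart) : LatticeDart := ⟨s.base + s.dir, s.dir * ω ^ 2⟩

/-- The same edge in the reverse direction. -/
def rev (s : LatticeDart) : LatticeDart := ⟨s.base + s.dir, -s.dir⟩

/-- The small lattice triangle on the left of the directed edge. -/
def tri (s : LatticeDart) : Set ℂ :=
  triangle s.base (s.base + s.dir) (s.base + s.dir * ω)

/-- The edge without its endpoints. -/
def edge (s : LatticeDart) : Set ℂ :=
  openSegment ℝ (toPlane s.base) (toPlane (s.base + s.dir))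

end LatticeDart

/-- A finite triangulation of the oriented sphere, as a combinatorial map. A dart is a directed
edge, which is identified with its left triangle having this side marked. -/
structure TriangulatedSphere where
  Dart : Type
  [fintypeDart : Fintype Dart]
  /-- the next directed side, counterclockwise, of the triangle on the left -/
  next : Equiv.Perm Dart
  /-- the same edge in the reverse direction -/
  rev : Equiv.Perm Dart
  next_ne : ∀ d, next d ≠ d
  next_next_next : ∀ d, next (next (next d)) = d
  rev_ne : ∀ d, rev d ≠ d
  rev_rev : ∀ d, rev (rev d) = d
  connected : ∀ d e, ∃ g ∈ Subgroup.closure {next, rev}, g d = e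
  /-- Euler's formula: triangles - edges + vertices = 2. The vertices are the orbits of the
  rotation `rev * next⁻¹` about the origin of a dart. -/
  euler : (Nat.card (Quotient (Equiv.Perm.SameCycle.setoid next)) : ℤ)
      - Nat.card (Quotient (Equiv.Perm.SameCycle.setoid rev))
      + Nat.card (Quotient (Equiv.Perm.SameCycle.setoid (rev * next⁻¹))) = 2

namespace TriangulatedSphere

/-- The degree of the vertex at the origin of a dart: the length of its orbit under the
rotation (counterclockwise) about this vertex. -/
def degree (M : TriangulatedSphere) (d : M.Dart) : ℕ :=
  Function.minimalPeriod (M.rev * M.next⁻¹) d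

end TriangulatedSphere

/-- A fullerene, given by its dual triangulation: a trivalent map on the sphere all of whose
faces are pentagons or hexagons. Triangles are carbon atoms, vertices of degree 5 and 6 are the
(centres of the) pentagons and hexagons. -/
structure Fullerene extends TriangulatedSphere where
  degree_eq : ∀ d, toTriangulatedSphere.degree d = 5 ∨ toTriangulatedSphere.degree d = 6

open Eisenstein in
/-- An unfolding onto the Eisenstein plane of a surface which is glued, in the pattern of `M`,
from flat triangles with lattice points as corners: each triangle of `M` is placed in the
plane, and twin sides are matched by a lattice rotation. -/
structure Unfolding (M : TriangulatedSphere) where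
  /-- the place of the origin of `e` in the placed triangle on the left of `e` -/
  corner : M.Dart → Eisenstein
  positive : ∀ e, 0 < det (corner (M.next e) - corner e) (corner (M.next (M.next e)) - corner e)
  /-- the rotation which takes the side `e` to its twin, reversed -/
  turn : M.Dart → Eisensteinˣ
  turn_spec : ∀ e, (turn e : Eisenstein) * (corner (M.next e) - corner e) =
    corner (M.rev e) - corner (M.next (M.rev e))

namespace Unfolding

open Eisenstein

variable {M : TriangulatedSphere} (X : Unfolding M)

/-- The placed flat triangle on the left of `e`. -/
def facet (e : M.Dart) : Set ℂ :=
  triangle (X.corner e) (X.corner (M.next e)) (X.corner (M.next (M.next e)))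

/-- The side `e` of the placed triangle, without its endpoints. -/
def side (e : M.Dart) : Set ℂ :=
  openSegment ℝ (toPlane (X.corner e)) (toPlane (X.corner (M.next e)))

/-- The length of the side `e`, where neighbouring lattice points have distance `1`. -/
def sideLength (e : M.Dart) : ℝ :=
  dist (toPlane (X.corner e)) (toPlane (X.corner (M.next e)))

/-- The lattice motion which carries the side `e` to its twin (with `corner e` going to the end
of `rev e`), so that the triangle across the side `e`, as seen from the triangle of `e`, is
carried to the placed triangle of `rev e`. -/
def move (e : M.Dart) (s : LatticeDart) : LatticeDart :=
  ⟨X.turn e * (s.base - X.corner e) + X.corner (M.next (M.rev e)), X.turn e * s.dir⟩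

/-- The small triangle of `s` overlaps the placed triangle of `e`. -/
def Meets (e : M.Dart) (s : LatticeDart) : Prop :=
  (interior s.tri ∩ interior (X.facet e)).Nonempty

/-- The edge `s` touches the side `e` in an inner point of both, its left small triangle overlaps
the placed triangle of `e`, and the small triangle on its right overlaps the triangle which lies
across the side `e`. -/
def MeetsAcross (e : M.Dart) (s : LatticeDart) : Prop :=
  (s.edge ∩ X.side e).Nonempty ∧ X.Meets e s ∧ X.Meets (M.rev e) (X.move e s.rev)

/-- One step between two placements of the same small triangle: the three sides of a facet share
one placed triangle, and a small triangle cut by the side `e` is also seen beyond that side. -/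
inductive Step : M.Dart × LatticeDart → M.Dart × LatticeDart → Prop
  | face (e : M.Dart) (s : LatticeDart) : Step (e, s) (M.next e, s)
  | cross (e : M.Dart) (s : LatticeDart) (h : (interior s.tri ∩ X.side e).Nonempty) :
      Step (e, s) (M.rev e, X.move e s)

end Unfolding

open Eisenstein in
/-- A decomposition, in the pattern of `M`, of the flat surface of `F` (every triangle of `F`
being a unit equilateral triangle) into flat geodesic triangles whose corners are vertices of
`F`. The function `chart e` tells which dart of `F` is seen at which place of the lattice when
the facet on the left of `e` is unfolded; only its values on small triangles that overlap the
facet matter. -/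
structure GeodesicTriangulation (M F : TriangulatedSphere) extends Unfolding M where
  chart : M.Dart → LatticeDart → F.Dart
  chart_face : ∀ e s, chart (M.next e) s = chart e s
  /-- inside a facet the surface looks like the plane lattice -/
  chart_next : ∀ e s, toUnfolding.Meets e s → chart e s.next = F.next (chart e s)
  chart_rev : ∀ e s, toUnfolding.Meets e s → toUnfolding.Meets e s.rev →
    chart e s.rev = F.rev (chart e s)
  /-- facets fit together along common sides -/
  chart_cross : ∀ e s, (interior s.tri ∩ toUnfolding.side e).Nonempty →
    chart (M.rev e) (toUnfolding.move e s) = chart e s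
  chart_rev_cross : ∀ e s, toUnfolding.MeetsAcross e s →
    chart (M.rev e) (toUnfolding.move e s.rev) = F.rev (chart e s)
  /-- facets do not overlap: different placements of a small triangle of `F` are related by
  passing from facet to facet within this small triangle -/
  once : ∀ e s e' s', toUnfolding.Meets e s → toUnfolding.Meets e' s' →
    chart e s = chart e' s' → Relation.EqvGen toUnfolding.Step (e, s) (e', s')
  /-- the facets cover the surface: every edge of `F`, together with the small triangles on both
  of its sides, is seen inside of a facet or across a side -/
  cover : ∀ t, ∃ e s, chart e s = t ∧
    ((toUnfolding.Meets e s ∧ toUnfolding.Meets e s.rev) ∨ toUnfolding.MeetsAcross e s)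

open Eisenstein in
/-- `F` results from the fullerene `A` by the Goldberg–Coxeter transformation `(k, l)`: each
triangle of the dual of `A` is replaced by an equilateral graphene patch whose sides are
`k + l ω`, up to lattice rotations. -/
def IsGoldbergCoxeter (k l : ℤ) (A F : Fullerene) : Prop :=
  ∃ X : GeodesicTriangulation A.toTriangulatedSphere F.toTriangulatedSphere,
    ∀ e, ∃ u : Eisensteinˣ,
      X.corner (A.next e) - X.corner e = u * ⟨k, l⟩ ∧
      X.corner (A.next (A.next e)) - X.corner e = u * ⟨k, l⟩ * ω

open Eisenstein in
/-- A master polyhedron of the fullerene `F`: a decomposition of its surface into flat triangles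
(facets), whose vertices are exactly the pentagons of `F`. Facets and master edges are given by
the darts of `pattern`. -/
structure MasterPolyhedron (F : Fullerene) where
  pattern : TriangulatedSphere
  net : GeodesicTriangulation pattern F.toTriangulatedSphere
  pentagon_iff : ∀ e s, net.Meets e s → toPlane s.base ∈ net.facet e →
    (F.degree (net.chart e s) = 5 ↔
      s.base = net.corner e ∨ s.base = net.corner (pattern.next e) ∨
        s.base = net.corner (pattern.next (pattern.next e)))

namespace MasterPolyhedron

variable {F : Fullerene} (P : MasterPolyhedron F)

/-- The area of the facet on the left of `e`. -/
def facetArea (e : P.pattern.Dart) : ℝ := Eisenstein.area (P.net.facet e)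

/-- The length of the master edge `e`. -/
def edgeLength (e : P.pattern.Dart) : ℝ := P.net.sideLength e

end MasterPolyhedron

end

/-!
Put `κ = k + l ω`. The corners of the patches that replace the triangles of `A` form, wherever the
surface of `F` is unfolded, a coset of the sublattice of multiples of `κ`. This is recorded by a
label in `ℤ[ω] / κ` on every dart of `F`: the position of its origin relative to a corner of a patch,
in coordinates in which the dart points in the direction `1`
(`GeodesicTriangulation.sublatticeLabel`). The label is well defined because passing from one patch
to the next changes the position by a multiple of `κ`, and it obeys the transformation rules of a
position under `next` and `rev` (`SublatticeLabel`). One step of the rotation about the origin of a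
dart multiplies the label by `ω⁻¹`. Five steps return to the same dart if the origin is a pentagon, and
`ω ^ 5 - 1` is a unit, so every pentagon has label `0`
(`SublatticeLabel.label_eq_zero_of_degree_eq_five`): it is a corner of a patch.

Now unfold a facet of a master polyhedron. Each small triangle that overlaps the facet determines,
through its label, a coset of the multiples of `κ`. The coset agrees for small triangles with a common
side, and the small triangles that overlap the facet are connected through common sides because the
interior of the facet is connected, so there is only one coset (`SublatticeLabel.exists_offset_eq`).
The corners of the facet are pentagons, hence lie in this coset, and the sides of the facet are
multiples of `κ` (`MasterPolyhedron.dvd_corner_sub`). Squared lengths are given by the form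
`a ^ 2 + a b + b ^ 2`, which is multiplicative, and areas are given by determinants (`area_triangle`),
which are multiplied by the same form at `κ` when both sides are multiplied by `κ`.
-/

noncomputable section

namespace Eisenstein

theorem ω_mul_ω : ((ω : Eisenstein)) * ω = ω - 1 := by
  ext <;> simp [ω, QuadraticAlgebra.re_one, QuadraticAlgebra.im_one]

theorem ω_pow_three : (ω : Eisensteinˣ) ^ 3 = -1 := by
  ext <;> simp [ω, pow_succ, QuadraticAlgebra.re_one, QuadraticAlgebra.im_one]

end Eisenstein

open Eisenstein

theorem LatticeDart.tri_next (s : LatticeDart) : s.next.tri = s.tri := by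
  have h := ω_mul_ω
  have h1 : s.next.base + s.next.dir = s.base + s.dir * ω := by
    simp only [LatticeDart.next, Units.val_mul, Units.val_pow_eq_pow_val]
    linear_combination (s.dir : Eisenstein) * h
  have h2 : s.next.base + s.next.dir * ω = s.base := by
    simp only [LatticeDart.next, Units.val_mul, Units.val_pow_eq_pow_val]
    linear_combination (s.dir : Eisenstein) * (1 + ω) * h
  unfold LatticeDart.tri
  rw [h1, h2]
  unfold triangle
  congr 1
  simp only [LatticeDart.next]
  ext z
  simp only [Set.mem_insert_iff, Set.mem_singleton_iff]
  tauto

/-! ### Residues of lattice edges in an unfolding -/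

namespace Unfolding

variable {M : TriangulatedSphere} (X : Unfolding M)

theorem Meets.next {X : Unfolding M} {e : M.Dart} {s : LatticeDart} (h : X.Meets e s) :
    X.Meets e s.next := by
  unfold Unfolding.Meets at *
  rwa [LatticeDart.tri_next]

/-- All sides of the placed triangles, as lattice vectors, are divisible by `κ`. -/
def SidesDvd (κ : Eisenstein) : Prop :=
  ∀ e, κ ∣ X.corner (M.next e) - X.corner e

/-- The position modulo `κ` of the origin of the lattice edge `s`, seen from a corner of the
placed triangle of `e`, in the coordinates in which `s` points in the direction `1`. -/
def residue (κ : Eisenstein) (e : M.Dart) (s : LatticeDart) : Eisenstein ⧸ Ideal.span {κ} :=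
  Ideal.Quotient.mk _ ((s.base - X.corner e) * (s.dir⁻¹ : Eisensteinˣ))

variable {X} {κ : Eisenstein}

theorem residue_face (hX : X.SidesDvd κ) (e : M.Dart) (s : LatticeDart) :
    X.residue κ (M.next e) s = X.residue κ e s := by
  refine Ideal.Quotient.eq.2 (Ideal.mem_span_singleton.2 ?_)
  rw [← sub_mul, sub_sub_sub_cancel_left, ← neg_sub, neg_mul]
  exact ((hX e).mul_right _).neg_right

theorem residue_move (hX : X.SidesDvd κ) (e : M.Dart) (s : LatticeDart) :
    X.residue κ (M.rev e) (X.move e s) = X.residue κ e s := by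
  refine Ideal.Quotient.eq.2 (Ideal.mem_span_singleton.2 ?_)
  have h : ((X.move e s).base - X.corner (M.rev e)) * ((X.move e s).dir⁻¹ : Eisensteinˣ) -
      (s.base - X.corner e) * (s.dir⁻¹ : Eisensteinˣ) =
      (X.corner (M.next (M.rev e)) - X.corner (M.rev e)) *
        ((X.turn e * s.dir)⁻¹ : Eisensteinˣ) := by
    have h1 : (X.turn e : Eisenstein) * ((X.turn e)⁻¹ : Eisensteinˣ) = 1 := Units.mul_inv _
    simp only [Unfolding.move, mul_inv, Units.val_mul]
    linear_combination (s.base - X.corner e) * (s.dir⁻¹ : Eisensteinˣ) * h1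
  rw [h]
  exact (hX _).mul_right _

/-- Placements of the same small triangle have the same residue. -/
theorem residue_eq_of_eqvGen (hX : X.SidesDvd κ) {p q : M.Dart × LatticeDart}
    (h : Relation.EqvGen X.Step p q) : X.residue κ p.1 p.2 = X.residue κ q.1 q.2 := by
  induction h with
  | rel p q h =>
    cases h with
    | face e s => exact (residue_face hX e s).symm
    | cross e s h => exact (residue_move hX e s).symm
  | refl p => rfl
  | symm p q _ ih => exact ih.symm
  | trans p q r _ _ ih₁ ih₂ => exact ih₁.trans ih₂

end Unfolding

/-! ### Labels modulo a sublattice on the darts of a triangulation -/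

/-- A labelling of the darts of `F` by residues modulo `κ` which behaves like the position, modulo
`κ`, of the origin of a dart relative to a `κ`-sublattice, in the coordinates in which the dart
points in the direction `1`. -/
structure SublatticeLabel (F : TriangulatedSphere) (κ : Eisenstein) where
  /-- the label of a dart -/
  label : F.Dart → Eisenstein ⧸ Ideal.span {κ}
  label_next : ∀ t, label (F.next t) * Ideal.Quotient.mk _ (ω : Eisenstein) ^ 2 = label t + 1
  label_rev : ∀ t, label (F.rev t) = -(label t + 1)

namespace SublatticeLabel

variable {F : TriangulatedSphere} {κ : Eisenstein} (φ : SublatticeLabel F κ)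

/-- Turning around the origin of a dart leaves the origin in place, but the coordinates in which its
position is measured turn by `ω`. -/
theorem label_rotate (t : F.Dart) :
    φ.label ((F.rev * F.next⁻¹) t) * Ideal.Quotient.mk _ (ω : Eisenstein) = φ.label t := by
  obtain ⟨t, rfl⟩ := F.next.surjective t
  have h := φ.label_next t
  have h3 : (Ideal.Quotient.mk (Ideal.span {κ}) (ω : Eisenstein)) ^ 3 = -1 := by
    rw [← map_pow, ← Units.val_pow_eq_pow_val, ω_pow_three]
    simp
  have hr : (F.rev * F.next⁻¹) (F.next t) = F.rev t := by simp [Equiv.Perm.mul_apply]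
  rw [hr, φ.label_rev, ← h]
  linear_combination (-φ.label (F.next t)) * h3

theorem label_rotate_iterate (n : ℕ) (t : F.Dart) :
    φ.label ((F.rev * F.next⁻¹)^[n] t) * Ideal.Quotient.mk _ (ω : Eisenstein) ^ n =
      φ.label t := by
  induction n with
  | zero => simp
  | succ n ih =>
    rw [Function.iterate_succ_apply', pow_succ', ← mul_assoc, label_rotate, ih]

/-- A full turn around a pentagon shows that the label is fixed by the fifth power of `ω`, and
`ω ^ 5 - 1 = -ω` is a unit. -/
theorem label_eq_zero_of_degree_eq_five {t : F.Dart} (ht : F.degree t = 5) : φ.label t = 0 := by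
  have h := φ.label_rotate_iterate 5 t
  rw [← ht, TriangulatedSphere.degree, Function.iterate_minimalPeriod,
    ← TriangulatedSphere.degree, ht] at h
  have hω : (Ideal.Quotient.mk (Ideal.span {κ}) (ω : Eisenstein)) ^ 2 =
      Ideal.Quotient.mk _ (ω : Eisenstein) - 1 := by
    rw [sq, ← map_mul, ω_mul_ω, map_sub, map_one]
  generalize Ideal.Quotient.mk (Ideal.span {κ}) (ω : Eisenstein) = w at h hω
  have h5 : w ^ 5 = 1 - w := by linear_combination (w ^ 3 + w ^ 2 - 1) * hω
  have h0 : φ.label t * w = 0 := by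
    linear_combination φ.label t * h5 - h
  have h1 : w * (1 - w) = 1 := by linear_combination -hω
  linear_combination (1 - w) * h0 - φ.label t * h1

end SublatticeLabel

namespace GeodesicTriangulation

variable {M F : TriangulatedSphere} {κ : Eisenstein}

/-- If the sides of all facets are divisible by `κ`, the corners of the facets lie in a
`κ`-sublattice of the surface, whose labels are the residues read off in any facet. -/
def sublatticeLabel (X : GeodesicTriangulation M F) (hX : X.toUnfolding.SidesDvd κ) :
    SublatticeLabel F κ := by
  let label : F.Dart → Eisenstein ⧸ Ideal.span {κ} := fun t =>
    X.residue κ (X.cover t).choose (X.cover t).choose_spec.choose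
  -- By `X.once` the choice of the facet and of the placement does not matter.
  have key : ∀ e s, X.Meets e s → label (X.chart e s) = X.residue κ e s := fun e s h => by
    obtain ⟨h1, h2⟩ := (X.cover (X.chart e s)).choose_spec.choose_spec
    have h3 : X.Meets _ _ := h2.elim (fun h => h.1) (fun h => h.2.1)
    exact Unfolding.residue_eq_of_eqvGen hX (X.once _ _ _ _ h3 h h1)
  have inv_mul : ∀ u : Eisensteinˣ, (u : Eisenstein) * (u⁻¹ : Eisensteinˣ) = 1 := Units.mul_inv
  have hrev : ∀ e s, X.residue κ e s.rev = -(X.residue κ e s + 1) := fun e s => by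
    rw [Unfolding.residue, Unfolding.residue, ← map_one (Ideal.Quotient.mk _), ← map_add,
      ← map_neg]
    congr 1
    simp only [LatticeDart.rev, inv_neg, Units.val_neg]
    linear_combination -inv_mul s.dir
  refine ⟨label, fun t => ?_, fun t => ?_⟩
  · obtain ⟨e, s, rfl, h⟩ := X.cover t
    have h : X.Meets e s := h.elim (fun h => h.1) (fun h => h.2.1)
    rw [← X.chart_next e s h, key _ _ h.next, key _ _ h, Unfolding.residue, Unfolding.residue,
      ← map_one (Ideal.Quotient.mk _), ← map_add, ← map_pow, ← map_mul]
    congr 1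
    have h1 := inv_mul (ω ^ 2)
    simp only [LatticeDart.next, mul_inv, Units.val_mul, Units.val_pow_eq_pow_val] at h1 ⊢
    linear_combination (s.base + s.dir - X.corner e) * (s.dir⁻¹ : Eisensteinˣ) * h1 +
      inv_mul s.dir
  · obtain ⟨e, s, rfl, h | h⟩ := X.cover t
    · rw [← X.chart_rev e s h.1 h.2, key _ _ h.1, key _ _ h.2, hrev]
    · rw [← X.chart_rev_cross e s h, key _ _ h.2.1, key _ _ h.2.2, Unfolding.residue_move hX, hrev]

end GeodesicTriangulation

/-! ### Lattice coordinates and areas in the plane -/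

namespace Eisenstein

theorem exp_two_pi_I_div_six :
    Complex.exp (2 * Real.pi * Complex.I / 6) = ⟨1 / 2, √3 / 2⟩ := by
  have h : (2 * Real.pi * Complex.I / 6 : ℂ) = ((Real.pi / 3 : ℝ) : ℂ) * Complex.I := by
    push_cast; ring
  rw [h, Complex.exp_mul_I, ← Complex.ofReal_cos, ← Complex.ofReal_sin, Real.cos_pi_div_three,
    Real.sin_pi_div_three]
  apply Complex.ext <;> simp

theorem toPlane_re (x : Eisenstein) : (toPlane x).re = x.re + x.im / 2 := by
  simp [toPlane, exp_two_pi_I_div_six]; ring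

theorem toPlane_im (x : Eisenstein) : (toPlane x).im = x.im * (√3 / 2) := by
  simp [toPlane, exp_two_pi_I_div_six]

theorem toPlane_sub (x y : Eisenstein) : toPlane (x - y) = toPlane x - toPlane y := by
  simp [toPlane]; ring

/-- The real coordinates of a point of the plane with respect to the basis `1`, `ω`. -/
def latticeBasis : Module.Basis (Fin 2) ℝ ℂ :=
  Module.Basis.ofEquivFun
    { toFun := fun z => ![z.re - z.im / √3, 2 * z.im / √3]
      invFun := fun v => ⟨v 0 + v 1 / 2, v 1 * (√3 / 2)⟩
      map_add' := fun z w => by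
        ext i; fin_cases i <;> simp <;> ring
      map_smul' := fun r z => by
        ext i; fin_cases i <;> simp <;> ring
      left_inv := fun z => by
        have : √3 ≠ 0 := by positivity
        apply Complex.ext <;> (simp; field_simp; try ring)
      right_inv := fun v => by
        have : √3 ≠ 0 := by positivity
        ext i; fin_cases i <;> (simp; field_simp; try ring) }

/-- The coordinate of a point along `1`. -/
def xCoord (z : ℂ) : ℝ := latticeBasis.equivFun z 0

/-- The coordinate of a point along `ω`. -/
def yCoord (z : ℂ) : ℝ := latticeBasis.equivFun z 1

theorem xCoord_eq (z : ℂ) : xCoord z = z.re - z.im / √3 := by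
  simp [xCoord, latticeBasis]

theorem yCoord_eq (z : ℂ) : yCoord z = 2 * z.im / √3 := by
  simp [yCoord, latticeBasis]

@[fun_prop]
theorem continuous_xCoord : Continuous xCoord := by
  simp_rw [funext xCoord_eq]; fun_prop

@[fun_prop]
theorem continuous_yCoord : Continuous yCoord := by
  simp_rw [funext yCoord_eq]; fun_prop

@[simp]
theorem xCoord_toPlane (x : Eisenstein) : xCoord (toPlane x) = x.re := by
  have : √3 ≠ 0 := by positivity
  rw [xCoord_eq, toPlane_re, toPlane_im]; field_simp; ring

@[simp]
theorem yCoord_toPlane (x : Eisenstein) : yCoord (toPlane x) = x.im := by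
  have : √3 ≠ 0 := by positivity
  rw [yCoord_eq, toPlane_im]; field_simp

theorem toPlane_eq_sum (x : Eisenstein) :
    toPlane x = (x.re : ℝ) • latticeBasis 0 + (x.im : ℝ) • latticeBasis 1 := by
  have := latticeBasis.sum_equivFun (toPlane x)
  rw [Fin.sum_univ_two] at this
  rw [← xCoord_toPlane, ← yCoord_toPlane]
  exact this.symm

theorem ext_coord {z w : ℂ} (hx : xCoord z = xCoord w) (hy : yCoord z = yCoord w) : z = w := by
  apply latticeBasis.equivFun.injective
  ext i
  fin_cases i
  · exact hx
  · exact hy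

theorem xCoord_add (z w : ℂ) : xCoord (z + w) = xCoord z + xCoord w := by simp [xCoord]
theorem yCoord_add (z w : ℂ) : yCoord (z + w) = yCoord z + yCoord w := by simp [yCoord]
theorem xCoord_smul (r : ℝ) (z : ℂ) : xCoord (r • z) = r * xCoord z := by
  simp [xCoord, -Complex.real_smul]
theorem yCoord_smul (r : ℝ) (z : ℂ) : yCoord (r • z) = r * yCoord z := by
  simp [yCoord, -Complex.real_smul]

theorem mem_triangle_iff {x y z : Eisenstein} {w : ℂ} :
    w ∈ triangle x y z ↔ ∃ r s t : ℝ, 0 ≤ r ∧ 0 ≤ s ∧ 0 ≤ t ∧ r + s + t = 1 ∧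
      xCoord w = r * x.re + s * y.re + t * z.re ∧
      yCoord w = r * x.im + s * y.im + t * z.im := by
  rw [triangle]
  constructor
  · intro h
    rw [convexHull_insert (Set.insert_nonempty _ _), mem_convexJoin] at h
    obtain ⟨_, rfl, p, hp, r, q, hr, hq, h1, rfl⟩ := h
    rw [convexHull_pair] at hp
    obtain ⟨s, t, hs, ht, h2, rfl⟩ := hp
    refine ⟨r, q * s, q * t, hr, by positivity, by positivity, ?_, ?_, ?_⟩
    · linear_combination h1 + q * h2
    · simp only [xCoord_add, xCoord_smul, xCoord_toPlane]; ring
    · simp only [yCoord_add, yCoord_smul, yCoord_toPlane]; ring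
  · rintro ⟨r, s, t, hr, hs, ht, h1, hx, hy⟩
    have hw : w = ∑ i : Fin 3, ![r, s, t] i • ![toPlane x, toPlane y, toPlane z] i := by
      rw [Fin.sum_univ_three]
      apply ext_coord
      · simp [xCoord_add, xCoord_smul, hx, -Complex.real_smul]
      · simp [yCoord_add, yCoord_smul, hy, -Complex.real_smul]
    rw [hw]
    refine (convex_convexHull ℝ _).sum_mem (fun i _ => ?_) ?_ (fun i _ => ?_)
    · fin_cases i <;> simpa
    · rw [Fin.sum_univ_three]; simpa using h1
    · apply subset_convexHull
      fin_cases i <;> simp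

theorem convex_triangle (x y z : Eisenstein) : Convex ℝ (triangle x y z) := convex_convexHull ℝ _

theorem isCompact_triangle (x y z : Eisenstein) : IsCompact (triangle x y z) :=
  Set.Finite.isCompact_convexHull ℝ (Set.toFinite _)

open MeasureTheory

/-- A lattice triangle is the image of the triangle `0`, `1`, `ω` under an affine map, whose linear
part has the determinant of two of its sides in the basis `1`, `ω`. -/
theorem volume_triangle (x y z : Eisenstein) :
    volume.real (triangle x y z) = |(det (y - x) (z - x) : ℝ)| * volume.real (triangle 0 1 ω) := by
  let A : Matrix (Fin 2) (Fin 2) ℝ :=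
    !![((y - x).re : ℝ), ((z - x).re : ℝ); ((y - x).im : ℝ), ((z - x).im : ℝ)]
  let f : ℂ →ₗ[ℝ] ℂ := Matrix.toLin latticeBasis latticeBasis A
  have hf : LinearMap.det f = (det (y - x) (z - x) : ℝ) := by
    rw [LinearMap.det_toLin, Matrix.det_fin_two]
    simp [A, det]; ring
  have h0 : f (latticeBasis 0) = toPlane (y - x) := by
    rw [Matrix.toLin_self, Fin.sum_univ_two, toPlane_eq_sum]; simp [A]
  have h1 : f (latticeBasis 1) = toPlane (z - x) := by
    rw [Matrix.toLin_self, Fin.sum_univ_two, toPlane_eq_sum]; simp [A]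
  have himg : (fun w => toPlane x + w) '' (f '' triangle 0 1 ω) = triangle x y z := by
    have h2 : f '' triangle 0 1 ω = triangle 0 (y - x) (z - x) := by
      rw [triangle, triangle, LinearMap.image_convexHull, Set.image_insert_eq, Set.image_insert_eq,
        Set.image_singleton, toPlane_eq_sum 0, toPlane_eq_sum 1, toPlane_eq_sum ω]
      simp [ω, h0, h1, QuadraticAlgebra.re_one, QuadraticAlgebra.im_one, -Complex.real_smul]
    rw [h2]
    ext w
    constructor
    · rintro ⟨v, hv, rfl⟩
      obtain ⟨r, s, t, hr, hs, ht, h1, hx, hy⟩ := mem_triangle_iff.1 hv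
      refine mem_triangle_iff.2 ⟨r, s, t, hr, hs, ht, h1, ?_, ?_⟩
      · rw [xCoord_add, hx, xCoord_toPlane]
        push_cast [QuadraticAlgebra.re_sub, QuadraticAlgebra.re_zero]
        linear_combination -(x.re : ℝ) * h1
      · rw [yCoord_add, hy, yCoord_toPlane]
        push_cast [QuadraticAlgebra.im_sub, QuadraticAlgebra.im_zero]
        linear_combination -(x.im : ℝ) * h1
    · intro hw
      obtain ⟨r, s, t, hr, hs, ht, h1, hx, hy⟩ := mem_triangle_iff.1 hw
      have hxw : xCoord w = x.re + xCoord (w - toPlane x) := by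
        rw [← xCoord_toPlane, ← xCoord_add]; simp
      have hyw : yCoord w = x.im + yCoord (w - toPlane x) := by
        rw [← yCoord_toPlane, ← yCoord_add]; simp
      refine ⟨w - toPlane x, mem_triangle_iff.2 ⟨r, s, t, hr, hs, ht, h1, ?_, ?_⟩, by simp⟩
      · push_cast [QuadraticAlgebra.re_sub, QuadraticAlgebra.re_zero]
        linear_combination hx - hxw + (x.re : ℝ) * h1
      · push_cast [QuadraticAlgebra.im_sub, QuadraticAlgebra.im_zero]
        linear_combination hy - hyw + (x.im : ℝ) * h1
  rw [← himg, measureReal_def, Set.image_add_left, measure_preimage_add,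
    Measure.addHaar_image_linearMap, hf, ENNReal.toReal_mul,
    ENNReal.toReal_ofReal (abs_nonneg _), ← measureReal_def]

end Eisenstein

/-! ### The small triangles of the lattice -/

theorem Eisenstein.val_ω_sq : ((ω ^ 2 : Eisensteinˣ) : Eisenstein) = ⟨-1, 1⟩ := by
  rw [Units.val_pow_eq_pow_val, sq, ω_mul_ω]
  ext <;> simp [ω, QuadraticAlgebra.re_one, QuadraticAlgebra.im_one]

namespace LatticeDart

/-- The lattice edge from `a + b ω` in the direction `1`; the triangle on its left has the corners
`(a, b)`, `(a + 1, b)`, `(a, b + 1)`. -/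
def up (a b : ℤ) : LatticeDart := ⟨⟨a, b⟩, 1⟩

/-- The lattice edge from `(a + 1) + (b + 1) ω` in the direction `-1`; the triangle on its left has
the corners `(a + 1, b + 1)`, `(a, b + 1)`, `(a + 1, b)`. -/
def down (a b : ℤ) : LatticeDart := ⟨⟨a + 1, b + 1⟩, -1⟩

theorem mem_tri_up {a b : ℤ} {z : ℂ} :
    z ∈ (up a b).tri ↔ a ≤ xCoord z ∧ b ≤ yCoord z ∧ xCoord z + yCoord z ≤ a + b + 1 := by
  rw [tri, mem_triangle_iff]
  simp only [up, Units.val_one, one_mul, QuadraticAlgebra.re_add, QuadraticAlgebra.im_add,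
    QuadraticAlgebra.re_one, QuadraticAlgebra.im_one, ω, add_zero, Int.cast_add, Int.cast_one]
  constructor
  · rintro ⟨r, s, t, hr, hs, ht, h1, hx, hy⟩
    have hx' : xCoord z = a + s := by linear_combination hx + a * h1
    have hy' : yCoord z = b + t := by linear_combination hy + b * h1
    refine ⟨?_, ?_, ?_⟩ <;> linarith
  · rintro ⟨h1, h2, h3⟩
    refine ⟨1 - (xCoord z - a) - (yCoord z - b), xCoord z - a, yCoord z - b, ?_, ?_, ?_, ?_, ?_, ?_⟩
    iterate 3 linarith
    iterate 3 ring

theorem mem_tri_down {a b : ℤ} {z : ℂ} :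
    z ∈ (down a b).tri ↔
      xCoord z ≤ a + 1 ∧ yCoord z ≤ b + 1 ∧ a + b + 1 ≤ xCoord z + yCoord z := by
  rw [tri, mem_triangle_iff]
  simp only [down, Units.val_neg, Units.val_one, neg_mul, one_mul, QuadraticAlgebra.re_add,
    QuadraticAlgebra.im_add, QuadraticAlgebra.re_neg, QuadraticAlgebra.im_neg,
    QuadraticAlgebra.re_one, QuadraticAlgebra.im_one, ω, neg_zero, add_zero, Int.cast_add,
    Int.cast_one, Int.cast_neg]
  constructor
  · rintro ⟨r, s, t, hr, hs, ht, h1, hx, hy⟩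
    have hx' : xCoord z = a + 1 - s := by linear_combination hx + (a + 1) * h1
    have hy' : yCoord z = b + 1 - t := by linear_combination hy + (b + 1) * h1
    refine ⟨?_, ?_, ?_⟩ <;> linarith
  · rintro ⟨h1, h2, h3⟩
    refine ⟨1 - (a + 1 - xCoord z) - (b + 1 - yCoord z), a + 1 - xCoord z, b + 1 - yCoord z,
      ?_, ?_, ?_, ?_, ?_, ?_⟩
    iterate 3 linarith
    iterate 3 ring

theorem exists_mem_tri (z : ℂ) : ∃ a b, z ∈ (up a b).tri ∨ z ∈ (down a b).tri := by
  refine ⟨⌊xCoord z⌋, ⌊yCoord z⌋, ?_⟩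
  rw [mem_tri_up, mem_tri_down]
  have h1 := Int.floor_le (xCoord z)
  have h2 := Int.floor_le (yCoord z)
  have h3 := (Int.lt_floor_add_one (xCoord z)).le
  have h4 := (Int.lt_floor_add_one (yCoord z)).le
  rcases le_total (xCoord z + yCoord z) (⌊xCoord z⌋ + ⌊yCoord z⌋ + 1) with h | h
  · exact Or.inl ⟨h1, h2, h⟩
  · exact Or.inr ⟨h3, h4, h⟩

theorem interior_tri_up_nonempty (a b : ℤ) : (interior (up a b).tri).Nonempty := by
  refine ⟨latticeBasis.equivFun.symm ![a + 1 / 3, b + 1 / 3], ?_⟩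
  refine interior_maximal (t := {z | (a : ℝ) < xCoord z ∧ (b : ℝ) < yCoord z ∧
    xCoord z + yCoord z < a + b + 1}) ?_ ?_ ?_
  · rintro z ⟨h1, h2, h3⟩
    exact mem_tri_up.2 ⟨h1.le, h2.le, h3.le⟩
  · exact (isOpen_lt continuous_const continuous_xCoord).inter
      ((isOpen_lt continuous_const continuous_yCoord).inter
        (isOpen_lt (continuous_xCoord.add continuous_yCoord) continuous_const))
  · simp only [Set.mem_ofPred_eq, xCoord, yCoord, LinearEquiv.apply_symm_apply,
      Matrix.cons_val_zero, Matrix.cons_val_one]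
    refine ⟨?_, ?_, ?_⟩ <;> linarith

theorem interior_tri_down_nonempty (a b : ℤ) : (interior (down a b).tri).Nonempty := by
  refine ⟨latticeBasis.equivFun.symm ![a + 2 / 3, b + 2 / 3], ?_⟩
  refine interior_maximal (t := {z | xCoord z < a + 1 ∧ yCoord z < b + 1 ∧
    a + b + 1 < xCoord z + yCoord z}) ?_ ?_ ?_
  · rintro z ⟨h1, h2, h3⟩
    exact mem_tri_down.2 ⟨h1.le, h2.le, h3.le⟩
  · exact (isOpen_lt continuous_xCoord continuous_const).inter
      ((isOpen_lt continuous_yCoord continuous_const).inter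
        (isOpen_lt continuous_const (continuous_xCoord.add continuous_yCoord)))
  · simp only [Set.mem_ofPred_eq, xCoord, yCoord, LinearEquiv.apply_symm_apply,
      Matrix.cons_val_zero, Matrix.cons_val_one]
    refine ⟨?_, ?_, ?_⟩ <;> linarith

theorem rev_up (a b : ℤ) : (up a b).rev = down a (b - 1) := by
  simp only [up, down, rev, LatticeDart.mk.injEq, and_true]
  ext <;> simp [QuadraticAlgebra.re_one, QuadraticAlgebra.im_one]

theorem rev_next_up (a b : ℤ) : (up a b).next.rev = (down a b).next := by
  simp only [up, down, next, rev, LatticeDart.mk.injEq]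
  constructor
  · rw [one_mul, val_ω_sq]
    ext <;> simp [QuadraticAlgebra.re_one, QuadraticAlgebra.im_one]
  · simp

theorem rev_next_next_up (a b : ℤ) : (up a b).next.next.rev = (down (a - 1) b).next.next := by
  have h : ω ^ 2 * ω ^ 2 = -ω := by
    rw [← pow_add, pow_succ, ω_pow_three, neg_one_mul]
  simp only [up, down, next, rev, LatticeDart.mk.injEq]
  constructor
  · simp only [one_mul, neg_mul, Units.val_neg, h, val_ω_sq]
    ext <;> simp [ω, QuadraticAlgebra.re_one, QuadraticAlgebra.im_one]
  · simp

/-- Lattice triangles close to a point contain this point. -/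
theorem eventually_mem_tri (z : ℂ) : ∀ᶠ w in nhds z, ∀ a b,
    (w ∈ (up a b).tri → z ∈ (up a b).tri) ∧ (w ∈ (down a b).tri → z ∈ (down a b).tri) := by
  -- The bounds on the coordinates that define a lattice triangle are integers.
  have key : ∀ f : ℂ → ℝ, Continuous f → ∀ᶠ w in nhds z, ∀ n : ℤ,
      ((n : ℝ) ≤ f w → (n : ℝ) ≤ f z) ∧ (f w ≤ n → f z ≤ n) := fun f hf => by
    have h1 : ∀ᶠ w in nhds z, f w < ⌊f z⌋ + 1 :=
      hf.continuousAt.eventually_lt_const (Int.lt_floor_add_one _)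
    have h2 : ∀ᶠ w in nhds z, ⌈f z⌉ - 1 < f w :=
      hf.continuousAt.eventually_const_lt (by linarith [Int.ceil_lt_add_one (f z)])
    filter_upwards [h1, h2] with w h1 h2 n
    refine ⟨fun h => Int.le_floor.1 (Int.lt_add_one_iff.1 ?_),
      fun h => Int.ceil_le.1 (Int.sub_one_lt_iff.1 ?_)⟩
    · exact_mod_cast h.trans_lt h1
    · exact_mod_cast h2.trans_le h
  filter_upwards [key xCoord (by fun_prop), key yCoord (by fun_prop),
    key (fun w => xCoord w + yCoord w) (by fun_prop)] with w hx hy hxy a b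
  rw [mem_tri_up, mem_tri_up, mem_tri_down, mem_tri_down]
  have h2 := hx (a + 1)
  have h4 := hy (b + 1)
  have h5 := hxy (a + b + 1)
  push_cast at h2 h4 h5
  exact ⟨fun h => ⟨(hx a).1 h.1, (hy b).1 h.2.1, h5.2 h.2.2⟩,
    fun h => ⟨h2.2 h.1, h4.2 h.2.1, h5.1 h.2.2⟩⟩

/-! ### Functions on the small triangles that meet a connected set -/

section Constancy

variable {Q : Type*} {cU cD : ℤ → ℤ → Q} {z : ℂ}
  (h₁ : ∀ a b, z ∈ (up a b).tri → z ∈ (down a b).tri → cU a b = cD a b)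
  (h₂ : ∀ a b, z ∈ (up (a + 1) b).tri → z ∈ (down a b).tri → cU (a + 1) b = cD a b)
  (h₃ : ∀ a b, z ∈ (up a (b + 1)).tri → z ∈ (down a b).tri → cU a (b + 1) = cD a b)

include h₁ h₂ h₃

theorem up_eq_down {a b a' b' : ℤ} (hU : z ∈ (up a b).tri) (hD : z ∈ (down a' b').tri) :
    cU a b = cD a' b' := by
  simp only [mem_tri_up, mem_tri_down] at *
  obtain ⟨u1, u2, u3⟩ := hU
  obtain ⟨d1, d2, d3⟩ := hD
  have i1 : a ≤ a' + 1 := by exact_mod_cast u1.trans d1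
  have i2 : b ≤ b' + 1 := by exact_mod_cast u2.trans d2
  have i3 : a' + b' ≤ a + b := by
    have : a' + b' + 1 ≤ a + b + 1 := by exact_mod_cast d3.trans u3
    linarith
  have hcases : (a = a' ∧ b = b') ∨ (a = a' + 1 ∧ b = b') ∨ (a = a' ∧ b = b' + 1) ∨
      (a = a' + 1 ∧ b' = b + 1) ∨ (a' = a + 1 ∧ b = b' + 1) ∨ (a = a' + 1 ∧ b = b' + 1) := by
    omega
  rcases hcases with ⟨rfl, rfl⟩ | ⟨rfl, rfl⟩ | ⟨rfl, rfl⟩ | ⟨rfl, rfl⟩ | ⟨rfl, rfl⟩ | ⟨rfl, rfl⟩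
  · exact h₁ _ _ ⟨u1, u2, u3⟩ ⟨d1, d2, d3⟩
  · exact h₂ _ _ ⟨u1, u2, u3⟩ ⟨d1, d2, d3⟩
  · exact h₃ _ _ ⟨u1, u2, u3⟩ ⟨d1, d2, d3⟩
  -- In the other cases `z` is a lattice point, and two more triangles around it lead from one
  -- triangle to the other.
  all_goals push_cast at *
  · refine (h₂ a' b ?_ ?_).trans ((h₃ a' b ?_ ?_).symm.trans (h₁ a' (b + 1) ?_ ?_)) <;>
      push_cast <;> refine ⟨?_, ?_, ?_⟩ <;> linarith
  · refine (h₃ a b' ?_ ?_).trans ((h₂ a b' ?_ ?_).symm.trans (h₁ (a + 1) b' ?_ ?_)) <;>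
      push_cast <;> refine ⟨?_, ?_, ?_⟩ <;> linarith
  · refine (h₂ a' (b' + 1) ?_ ?_).trans ((h₁ a' (b' + 1) ?_ ?_).symm.trans (h₃ a' b' ?_ ?_)) <;>
      push_cast <;> refine ⟨?_, ?_, ?_⟩ <;> linarith

/-- Two different triangles of the form `up a b` meet only in a lattice point, which lies in some
`down c d` as well. -/
theorem up_eq_up {a b a' b' : ℤ} (hU : z ∈ (up a b).tri) (hU' : z ∈ (up a' b').tri) :
    cU a b = cU a' b' := by
  by_cases hD : ∃ c d, z ∈ (down c d).tri
  · obtain ⟨c, d, hD⟩ := hD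
    exact (up_eq_down h₁ h₂ h₃ hU hD).trans (up_eq_down h₁ h₂ h₃ hU' hD).symm
  · have key : ∀ a b a' b' : ℤ, z ∈ (up a b).tri → z ∈ (up a' b').tri → a' ≤ a ∧ b' ≤ b := by
      intro a b a' b' hU hU'
      rw [mem_tri_up] at hU hU'
      by_contra hlt
      refine hD ⟨a, b, mem_tri_down.2 ?_⟩
      rw [not_and_or, not_le, not_le] at hlt
      rcases hlt with hlt | hlt
      all_goals
        have hlt := Int.cast_le (R := ℝ).2 (Int.add_one_le_iff.2 hlt)
        push_cast at hlt
        refine ⟨?_, ?_, ?_⟩ <;> linarith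
    obtain ⟨i1, i2⟩ := key _ _ _ _ hU hU'
    obtain ⟨i3, i4⟩ := key _ _ _ _ hU' hU
    rw [i1.antisymm i3, i2.antisymm i4]

/-- Two different triangles of the form `down a b` meet only in a lattice point, which lies in some
`up c d` as well. -/
theorem down_eq_down {a b a' b' : ℤ} (hD : z ∈ (down a b).tri) (hD' : z ∈ (down a' b').tri) :
    cD a b = cD a' b' := by
  by_cases hU : ∃ c d, z ∈ (up c d).tri
  · obtain ⟨c, d, hU⟩ := hU
    exact (up_eq_down h₁ h₂ h₃ hU hD).symm.trans (up_eq_down h₁ h₂ h₃ hU hD')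
  · have key : ∀ a b a' b' : ℤ, z ∈ (down a b).tri → z ∈ (down a' b').tri → a ≤ a' ∧ b ≤ b' := by
      intro a b a' b' hD hD'
      rw [mem_tri_down] at hD hD'
      by_contra hlt
      refine hU ⟨a, b, mem_tri_up.2 ?_⟩
      rw [not_and_or, not_le, not_le] at hlt
      rcases hlt with hlt | hlt
      all_goals
        have hlt := Int.cast_le (R := ℝ).2 (Int.add_one_le_iff.2 hlt)
        push_cast at hlt
        refine ⟨?_, ?_, ?_⟩ <;> linarith
    obtain ⟨i1, i2⟩ := key _ _ _ _ hD hD'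
    obtain ⟨i3, i4⟩ := key _ _ _ _ hD' hD
    rw [i1.antisymm i3, i2.antisymm i4]

end Constancy

/-- A function on lattice triangles which agrees on adjacent triangles that share a point of the
connected set `V` is constant on the triangles that meet `V`. -/
theorem exists_eq_of_isPreconnected {Q : Type*} {cU cD : ℤ → ℤ → Q} {V : Set ℂ}
    (hV : IsPreconnected V) (hne : V.Nonempty)
    (h₁ : ∀ z ∈ V, ∀ a b, z ∈ (up a b).tri → z ∈ (down a b).tri → cU a b = cD a b)
    (h₂ : ∀ z ∈ V, ∀ a b, z ∈ (up (a + 1) b).tri → z ∈ (down a b).tri → cU (a + 1) b = cD a b)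
    (h₃ : ∀ z ∈ V, ∀ a b, z ∈ (up a (b + 1)).tri → z ∈ (down a b).tri → cU a (b + 1) = cD a b) :
    ∃ q, ∀ z ∈ V, ∀ a b, (z ∈ (up a b).tri → cU a b = q) ∧ (z ∈ (down a b).tri → cD a b = q) := by
  have hloc : ∀ z : V, ∃ q, ∀ a b,
      ((z : ℂ) ∈ (up a b).tri → cU a b = q) ∧ ((z : ℂ) ∈ (down a b).tri → cD a b = q) := by
    rintro ⟨z, hz⟩
    have e₁ := h₁ z hz
    have e₂ := h₂ z hz
    have e₃ := h₃ z hz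
    obtain ⟨c, d, h | h⟩ := exists_mem_tri z
    · exact ⟨cU c d, fun a b => ⟨fun h' => up_eq_up e₁ e₂ e₃ h' h,
        fun h' => (up_eq_down e₁ e₂ e₃ h h').symm⟩⟩
    · exact ⟨cD c d, fun a b => ⟨fun h' => up_eq_down e₁ e₂ e₃ h' h,
        fun h' => down_eq_down e₁ e₂ e₃ h' h⟩⟩
  choose g hg using hloc
  have hgl : IsLocallyConstant g := by
    refine (IsLocallyConstant.iff_eventually_eq g).2 fun z => ?_
    filter_upwards [continuous_subtype_val.continuousAt.eventually (eventually_mem_tri z)]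
      with w hw
    obtain ⟨a, b, h | h⟩ := exists_mem_tri w
    · rw [← (hg w a b).1 h, ← (hg z a b).1 ((hw a b).1 h)]
    · rw [← (hg w a b).2 h, ← (hg z a b).2 ((hw a b).2 h)]
  obtain ⟨z₀, hz₀⟩ := hne
  have : PreconnectedSpace V := isPreconnected_iff_preconnectedSpace.1 hV
  refine ⟨g ⟨z₀, hz₀⟩, fun z hz => ?_⟩
  rw [hgl.apply_eq_of_preconnectedSpace ⟨z₀, hz₀⟩ ⟨z, hz⟩]
  exact hg ⟨z, hz⟩

/-- A lattice point in a lattice triangle is one of its corners. -/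
theorem base_eq_of_mem_tri {v : Eisenstein} {a b : ℤ} {s : LatticeDart}
    (hs : s = up a b ∨ s = down a b) (hv : toPlane v ∈ s.tri) :
    s.base = v ∨ s.next.base = v ∨ s.next.next.base = v := by
  rcases hs with rfl | rfl
  · rw [mem_tri_up, xCoord_toPlane, yCoord_toPlane] at hv
    norm_cast at hv
    simp only [up, next, one_mul, val_ω_sq, Units.val_one, QuadraticAlgebra.ext_iff,
      QuadraticAlgebra.re_add, QuadraticAlgebra.im_add, QuadraticAlgebra.re_one,
      QuadraticAlgebra.im_one]
    omega
  · rw [mem_tri_down, xCoord_toPlane, yCoord_toPlane] at hv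
    norm_cast at hv
    simp only [down, next, neg_mul, one_mul, val_ω_sq, Units.val_one, Units.val_neg,
      QuadraticAlgebra.ext_iff, QuadraticAlgebra.re_add, QuadraticAlgebra.im_add,
      QuadraticAlgebra.re_neg, QuadraticAlgebra.im_neg, QuadraticAlgebra.re_one,
      QuadraticAlgebra.im_one]
    omega

end LatticeDart

namespace Eisenstein

open MeasureTheory in
theorem volume_triangle_zero_one_ω_ne_zero : volume.real (triangle 0 1 ω) ≠ 0 := by
  have h : (LatticeDart.up 0 0).tri = triangle 0 1 ω := by
    have h0 : (⟨0, 0⟩ : Eisenstein) = 0 := rfl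
    simp [LatticeDart.tri, LatticeDart.up, h0]
  have h1 := LatticeDart.interior_tri_up_nonempty 0 0
  rw [h] at h1
  exact (ENNReal.toReal_pos (Measure.measure_pos_of_nonempty_interior volume h1).ne'
    (isCompact_triangle _ _ _).measure_lt_top.ne).ne'

theorem area_triangle (x y z : Eisenstein) :
    area (triangle x y z) = |(det (y - x) (z - x) : ℝ)| := by
  rw [area, volume_triangle, mul_div_cancel_right₀ _ volume_triangle_zero_one_ω_ne_zero]

open MeasureTheory in
theorem interior_triangle_nonempty {x y z : Eisenstein} (h : 0 < det (y - x) (z - x)) :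
    (interior (triangle x y z)).Nonempty := by
  -- A closed convex set without interior is contained in its frontier, so it has no area.
  by_contra hi
  have h1 := (convex_triangle x y z).addHaar_frontier volume
  rw [(isCompact_triangle x y z).isClosed.frontier_eq, Set.not_nonempty_iff_eq_empty.1 hi,
    Set.sdiff_empty] at h1
  have h2 := area_triangle x y z
  rw [area, measureReal_def, h1, ENNReal.toReal_zero, zero_div, abs_of_pos (by exact_mod_cast h)]
    at h2
  exact h.ne (by exact_mod_cast h2)

/-! ### Divisibility of areas and squared lengths -/

/-- The square of the absolute value of an Eisenstein integer. -/
def normForm (x : Eisenstein) : ℤ := x.re ^ 2 + x.re * x.im + x.im ^ 2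

theorem normForm_mul (x y : Eisenstein) : normForm (x * y) = normForm x * normForm y := by
  simp [normForm]; ring

theorem det_mul_mul (κ x y : Eisenstein) : det (κ * x) (κ * y) = normForm κ * det x y := by
  simp [normForm, det]; ring

theorem dist_toPlane_sq (x y : Eisenstein) :
    dist (toPlane x) (toPlane y) ^ 2 = (normForm (y - x) : ℝ) := by
  rw [dist_comm, dist_eq_norm, ← toPlane_sub, Complex.sq_norm, Complex.normSq_apply, toPlane_re,
    toPlane_im]
  have h : √3 * √3 = 3 := Real.mul_self_sqrt (by norm_num)
  simp only [normForm]
  push_cast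
  linear_combination ((y - x).im : ℝ) ^ 2 / 4 * h

end Eisenstein

theorem areaScaleFactor_eq (k l : ℤ) :
    areaScaleFactor k l = ((k ^ 2 + k * l + l ^ 2 : ℤ) : ℝ) := by
  have h : det (⟨k, l⟩ - 0) (⟨k, l⟩ * ω - 0) = k ^ 2 + k * l + l ^ 2 := by
    simp [det, ω]; ring
  rw [areaScaleFactor, area_triangle, ← Int.cast_abs, h, abs_of_nonneg]
  nlinarith [sq_nonneg (k + l), sq_nonneg k, sq_nonneg l]

/-! ### Sublattices inside a facet -/

theorem LatticeDart.convex_tri (s : LatticeDart) : Convex ℝ s.tri := convex_triangle _ _ _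

namespace Unfolding

variable {M : TriangulatedSphere} {X : Unfolding M} {e : M.Dart}

theorem convex_facet (e : M.Dart) : Convex ℝ (X.facet e) := convex_triangle _ _ _

/-- A small triangle which contains an inner point of a facet overlaps the facet. -/
theorem meets_of_mem {s : LatticeDart} (hs : (interior s.tri).Nonempty) {z : ℂ}
    (hz : z ∈ interior (X.facet e)) (h : z ∈ s.tri) : X.Meets e s := by
  have hc : z ∈ closure (interior s.tri) := by
    rw [s.convex_tri.closure_interior_eq_closure_of_nonempty_interior hs]
    exact subset_closure h
  obtain ⟨w, hw, hw'⟩ := mem_closure_iff.1 hc _ isOpen_interior hz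
  exact ⟨w, hw', hw⟩

theorem interior_facet_nonempty (e : M.Dart) : (interior (X.facet e)).Nonempty :=
  interior_triangle_nonempty (X.positive e)

end Unfolding

namespace SublatticeLabel

variable {M F : TriangulatedSphere} {κ : Eisenstein} (φ : SublatticeLabel F κ)
  (X : GeodesicTriangulation M F) (e : M.Dart)

/-- The class modulo `κ` of the points of the sublattice, in the unfolded facet of `e`, according
to the label of the small triangle seen at `s`. -/
def offset (s : LatticeDart) : Eisenstein ⧸ Ideal.span {κ} :=
  Ideal.Quotient.mk _ s.base - Ideal.Quotient.mk _ (s.dir : Eisenstein) * φ.label (X.chart e s)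

variable {X e}

theorem offset_next {s : LatticeDart} (h : X.Meets e s) :
    φ.offset X e s.next = φ.offset X e s := by
  have h1 := φ.label_next (X.chart e s)
  rw [offset, offset, X.chart_next e s h]
  simp only [LatticeDart.next, Units.val_mul, Units.val_pow_eq_pow_val, map_add, map_mul, map_pow]
  linear_combination -Ideal.Quotient.mk _ (s.dir : Eisenstein) * h1

theorem offset_rev {s : LatticeDart} (h : X.Meets e s) (h' : X.Meets e s.rev) :
    φ.offset X e s.rev = φ.offset X e s := by
  rw [offset, offset, X.chart_rev e s h h', φ.label_rev]
  simp only [LatticeDart.rev, Units.val_neg, map_add, map_neg]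
  ring

/-- The sublattice seen inside a facet is a single coset of the multiples of `κ`, since the small
triangles that overlap the convex facet are connected through common sides. -/
theorem exists_offset_eq : ∃ q, ∀ z ∈ interior (X.facet e), ∀ a b,
    (z ∈ (LatticeDart.up a b).tri → φ.offset X e (LatticeDart.up a b) = q) ∧
    (z ∈ (LatticeDart.down a b).tri → φ.offset X e (LatticeDart.down a b) = q) := by
  have mU : ∀ z ∈ interior (X.facet e), ∀ a b, z ∈ (LatticeDart.up a b).tri →
      X.Meets e (LatticeDart.up a b) := fun z hz a b =>
    Unfolding.meets_of_mem (LatticeDart.interior_tri_up_nonempty a b) hz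
  have mD : ∀ z ∈ interior (X.facet e), ∀ a b, z ∈ (LatticeDart.down a b).tri →
      X.Meets e (LatticeDart.down a b) := fun z hz a b =>
    Unfolding.meets_of_mem (LatticeDart.interior_tri_down_nonempty a b) hz
  refine LatticeDart.exists_eq_of_isPreconnected
    (cU := fun a b => φ.offset X e (LatticeDart.up a b))
    (cD := fun a b => φ.offset X e (LatticeDart.down a b))
    (X.convex_facet e).interior.isPreconnected (X.interior_facet_nonempty e)
    (fun z hz a b hU hD => ?_) (fun z hz a b hU hD => ?_) (fun z hz a b hU hD => ?_)
  · have hU := mU z hz _ _ hU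
    have hD := mD z hz _ _ hD
    rw [← φ.offset_next hU, ← φ.offset_next hD, ← LatticeDart.rev_next_up]
    refine (φ.offset_rev hU.next ?_).symm
    rw [LatticeDart.rev_next_up]
    exact hD.next
  · have hU := mU z hz _ _ hU
    have hD := mD z hz _ _ hD
    have hr := LatticeDart.rev_next_next_up (a + 1) b
    rw [add_sub_cancel_right] at hr
    rw [← φ.offset_next hU, ← φ.offset_next hU.next, ← φ.offset_next hD,
      ← φ.offset_next hD.next, ← hr]
    refine (φ.offset_rev hU.next.next ?_).symm
    rw [hr]
    exact hD.next.next
  · have hU := mU z hz _ _ hU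
    have hD := mD z hz _ _ hD
    have hr := LatticeDart.rev_up a (b + 1)
    rw [add_sub_cancel_right] at hr
    rw [← hr] at hD ⊢
    exact (φ.offset_rev hU hD).symm

/-- If every small triangle of a facet at one of two lattice points of the facet sits on a vertex
with label `0`, the two points differ by a multiple of `κ`. -/
theorem dvd_sub_of_label_eq_zero {v w : Eisenstein} (hv : toPlane v ∈ X.facet e)
    (hw : toPlane w ∈ X.facet e)
    (hv0 : ∀ s, X.Meets e s → s.base = v → φ.label (X.chart e s) = 0)
    (hw0 : ∀ s, X.Meets e s → s.base = w → φ.label (X.chart e s) = 0) : κ ∣ w - v := by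
  obtain ⟨q, hq⟩ := φ.exists_offset_eq (X := X) (e := e)
  have key : ∀ v : Eisenstein, toPlane v ∈ X.facet e →
      (∀ s, X.Meets e s → s.base = v → φ.label (X.chart e s) = 0) →
      Ideal.Quotient.mk _ v = q := by
    intro v hv hv0
    have hcl : toPlane v ∈ closure (interior (X.facet e)) := by
      rw [(X.convex_facet e).closure_interior_eq_closure_of_nonempty_interior
        (X.interior_facet_nonempty e)]
      exact subset_closure hv
    obtain ⟨z, hzi, hz⟩ := ((mem_closure_iff_frequently.1 hcl).and_eventually
      (LatticeDart.eventually_mem_tri (toPlane v))).exists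
    obtain ⟨s, hs, hm, ho, hvs⟩ : ∃ s : LatticeDart,
        (∃ a b, s = LatticeDart.up a b ∨ s = LatticeDart.down a b) ∧ X.Meets e s ∧
          φ.offset X e s = q ∧ toPlane v ∈ s.tri := by
      obtain ⟨a, b, h | h⟩ := LatticeDart.exists_mem_tri z
      · exact ⟨_, ⟨a, b, Or.inl rfl⟩,
          Unfolding.meets_of_mem (LatticeDart.interior_tri_up_nonempty a b) hzi h,
          (hq z hzi a b).1 h, (hz a b).1 h⟩
      · exact ⟨_, ⟨a, b, Or.inr rfl⟩,
          Unfolding.meets_of_mem (LatticeDart.interior_tri_down_nonempty a b) hzi h,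
          (hq z hzi a b).2 h, (hz a b).2 h⟩
    have hbase : ∀ s, X.Meets e s → φ.offset X e s = q → s.base = v →
        Ideal.Quotient.mk _ v = q := by
      intro s hm ho hb
      rwa [offset, hv0 s hm hb, mul_zero, sub_zero, hb] at ho
    obtain ⟨a, b, hs⟩ := hs
    rcases LatticeDart.base_eq_of_mem_tri hs hvs with h | h | h
    · exact hbase s hm ho h
    · exact hbase _ hm.next ((φ.offset_next hm).trans ho) h
    · exact hbase _ hm.next.next
        ((φ.offset_next hm.next).trans ((φ.offset_next hm).trans ho)) h
  rw [← Ideal.mem_span_singleton, ← Ideal.Quotient.eq, key v hv hv0, key w hw hw0]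

end SublatticeLabel

theorem Unfolding.toPlane_corner_mem_facet {M : TriangulatedSphere} (X : Unfolding M)
    (e : M.Dart) : toPlane (X.corner e) ∈ X.facet e ∧ toPlane (X.corner (M.next e)) ∈ X.facet e ∧
      toPlane (X.corner (M.next (M.next e))) ∈ X.facet e := by
  refine ⟨?_, ?_, ?_⟩ <;> exact subset_convexHull ℝ _ (by simp)

/-! ### Facets of a master polyhedron -/

/-- The sides of the unfolded facets of a master polyhedron are divisible by `κ`, because its
vertices are pentagons and so have label `0`. -/
theorem MasterPolyhedron.dvd_corner_sub {F : Fullerene} {κ : Eisenstein}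
    (φ : SublatticeLabel F.toTriangulatedSphere κ) (P : MasterPolyhedron F)
    (e : P.pattern.Dart) :
    κ ∣ P.net.corner (P.pattern.next e) - P.net.corner e ∧
      κ ∣ P.net.corner (P.pattern.next (P.pattern.next e)) - P.net.corner e := by
  obtain ⟨h0, h1, h2⟩ := P.net.toPlane_corner_mem_facet e
  have key : ∀ v : Eisenstein, toPlane v ∈ P.net.facet e →
      (v = P.net.corner e ∨ v = P.net.corner (P.pattern.next e) ∨
        v = P.net.corner (P.pattern.next (P.pattern.next e))) →
      ∀ s, P.net.Meets e s → s.base = v → φ.label (P.net.chart e s) = 0 := by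
    rintro v hv hc s hm rfl
    exact φ.label_eq_zero_of_degree_eq_five ((P.pentagon_iff e s hm hv).2 hc)
  exact ⟨φ.dvd_sub_of_label_eq_zero h0 h1 (key _ h0 (by simp)) (key _ h1 (by simp)),
    φ.dvd_sub_of_label_eq_zero h0 h2 (key _ h0 (by simp)) (key _ h2 (by simp))⟩

theorem theorem3 (k l : ℤ) (A F : Fullerene) (hF : IsGoldbergCoxeter k l A F)
    (P : MasterPolyhedron F) :
    areaScaleFactor k l = ((k ^ 2 + k * l + l ^ 2 : ℤ) : ℝ) ∧
    (∀ e : P.pattern.Dart, ∃ m : ℤ,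
      P.facetArea e = (m : ℝ) ∧ k ^ 2 + k * l + l ^ 2 ∣ m) ∧
    (∀ e : P.pattern.Dart, ∃ m : ℤ,
      P.edgeLength e ^ 2 = (m : ℝ) ∧ k ^ 2 + k * l + l ^ 2 ∣ m) := by
  obtain ⟨X, hX⟩ := hF
  have hsides : X.toUnfolding.SidesDvd ⟨k, l⟩ := fun e => by
    obtain ⟨u, hu, -⟩ := hX e
    exact ⟨u, by rw [hu, mul_comm]⟩
  have hdvd := P.dvd_corner_sub (X.sublatticeLabel hsides)
  refine ⟨areaScaleFactor_eq k l, fun e => ?_, fun e => ?_⟩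
  · obtain ⟨⟨x, hx⟩, y, hy⟩ := hdvd e
    refine ⟨|normForm ⟨k, l⟩ * det x y|, ?_, ?_⟩
    · rw [MasterPolyhedron.facetArea, Unfolding.facet, area_triangle, hx, hy, det_mul_mul,
        Int.cast_abs]
    · exact (dvd_abs _ _).2 (Dvd.intro _ rfl)
  · obtain ⟨⟨x, hx⟩, -⟩ := hdvd e
    refine ⟨normForm ⟨k, l⟩ * normForm x, ?_, Dvd.intro _ rfl⟩
    rw [MasterPolyhedron.edgeLength, Unfolding.sideLength, dist_toPlane_sq, hx, normForm_mul]

end
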